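/- All graphs are finite and simple. For a graph $G=(V,E)$ with $q=|E|$ edges, a local antimagic labeling of $G$ is a bijection $g:E\to\{1,2,\ldots,q\}$ such that the induced vertex labels $g^+(v)=\sum_{uv\in E}g(uv)$ satisfy $g^+(u)\ne g^+(v)$ for every edge $uv\in E$. Let $c(g)$ be the number of distinct values of $g^+$, and let the local antimagic chromatic number $\chi_{la}(G)$ be the minimum of $c(g)$ over all local antimagic labelings $g$ of $G$. For $m\ge 2$ and $n>r\ge 1$, let $A(mK_n,K_r)$ be the amalgamation of $m$ copies of the complete graph $K_n$ over $K_r$: its vertices are $v_{i,j}$ ($1\le i\le m$, $1\le j\le n$), where $v_{1,j}=\cdots=v_{m,j}$ are identified for each $n-r+1\le j\le n$ (and there are no other identifications), and its edges are $v_{i,j}v_{i,k}$ for $1\le i\le m$, $1\le j<k\le n$. Let $G\vee K_1$ be the graph obtained from $G$ by joining a new vertex to every vertex of $G$. Then for all integers $m\ge 2$, $n$ odd and $n>r\ge 3$, $$\chi_{la}(A(mK_{n+1},K_{r+1}))=\chi_{la}(A(mK_n,K_r)\vee K_1)=n+1;$$ in particular both graphs admit local antimagic labelings. -/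

import Mathlib

namespace LocalAntimagic

section Labelings

variable {V : Type*} [Fintype V]

open scoped Classical in
/-- The induced vertex label `g⁺(v) = ∑_{uv ∈ E(G)} g(uv)`. Only the values of `g` on edges of `G`
enter. -/
noncomputable def vertexSum (G : SimpleGraph V) (g : Sym2 V → ℕ) (v : V) : ℕ :=
  ∑ u ∈ G.neighborFinset v, g s(u, v)

/-- `g` is a local antimagic labeling of `G`: it maps the edge set bijectively onto `{1, …, q}`,
where `q` is the number of edges, and adjacent vertices receive different induced labels. -/
def IsLocalAntimagicLabeling (G : SimpleGraph V) (g : Sym2 V → ℕ) : Prop :=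
  Set.BijOn g G.edgeSet (Set.Icc 1 G.edgeSet.ncard) ∧
    ∀ u v : V, G.Adj u v → vertexSum G g u ≠ vertexSum G g v

/-- The color number `c(g)`: the number of distinct induced vertex labels. -/
noncomputable def colorNumber (G : SimpleGraph V) (g : Sym2 V → ℕ) : ℕ :=
  (Set.range (vertexSum G g)).ncard

/-- The local antimagic chromatic number `χ_la(G)`: the minimum of `c(g)` over all local antimagic
labelings `g` of `G`. It is `⊤` exactly when `G` has no local antimagic labeling. -/
noncomputable def localAntimagicChromaticNumber (G : SimpleGraph V) : ℕ∞ :=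
  ⨅ g : {g : Sym2 V → ℕ // IsLocalAntimagicLabeling G g}, (colorNumber G g.1 : ℕ∞)

end Labelings

/-- The join `G ∨ H`: the disjoint union together with all edges between the two parts. -/
def join {V W : Type*} (G : SimpleGraph V) (H : SimpleGraph W) : SimpleGraph (V ⊕ W) :=
  (G ⊕g H) ⊔ completeBipartiteGraph V W

section Amalgamation

variable {V : Type*} [DecidableEq V]

/-- Vertices of `m` copies of a graph on `V` after the copies of each vertex of `S` have been
identified: a vertex `(i, x)` for each copy `i` and each `x ∉ S`, and one vertex for each
`x ∈ S`. -/
abbrev AmalgamationVertex (m : ℕ) (S : Finset V) : Type _ :=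
  (Fin m × {x : V // x ∉ S}) ⊕ {x : V // x ∈ S}

/-- The vertex of the amalgamation to which the vertex `x` of the `i`-th copy is sent. -/
def copyVertex {m : ℕ} (S : Finset V) (i : Fin m) (x : V) : AmalgamationVertex m S :=
  if h : x ∈ S then Sum.inr ⟨x, h⟩ else Sum.inl (i, ⟨x, h⟩)

/-- The amalgamation of `m` copies of `G` over the subgraph induced by `S`: the edges are the
images of the edges of the copies. -/
def amalgamation (m : ℕ) (G : SimpleGraph V) (S : Finset V) :
    SimpleGraph (AmalgamationVertex m S) :=
  SimpleGraph.fromRel fun p q =>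
    ∃ (i : Fin m) (x y : V), G.Adj x y ∧ p = copyVertex S i x ∧ q = copyVertex S i y

end Amalgamation

/-- The last `r` vertices of `K_n` (vertices are numbered `0, …, n - 1`; intended for `r ≤ n`). -/
def lastVertices (n r : ℕ) : Finset (Fin n) :=
  Finset.univ.filter fun j => n ≤ (j : ℕ) + r

/-- `A(mK_n, K_r)`: the amalgamation of `m` copies of the complete graph `K_n` over the complete
graph `K_r` on its last `r` vertices. -/
def amalgamationComplete (m n r : ℕ) : SimpleGraph (AmalgamationVertex m (lastVertices n r)) :=
  amalgamation m (⊤ : SimpleGraph (Fin n)) (lastVertices n r)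

end LocalAntimagic

/-! Both graphs are `bookGraph`s with s = n - r own vertices per copy and R = r + 1 common ones,
since joining K_1 only adds a common vertex. Each copy is a clique on s + R = n + 1 vertices, which
gives the lower bound. For equality it suffices that the sum at an own vertex does not depend on its
copy, that sums increase strictly with the index among own and among common vertices, and that own
sums lie below common ones (`localAntimagicChromaticNumber_bookGraph_of_labels`).

Each pair of own vertices receives a block of m consecutive labels, one per copy, read upwards or
downwards. Passing from copy 0 to copy i then changes the inner part of the sum at a by i times
`slope s a`, which is -1 for even s, and 0 or -2 for odd s. The edges to common vertices must cancel
this (`sum_pendant_sub`). Alternating directions contribute 0 or 1, because R and s have equal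
parity; interleaving the k = 0 blocks of consecutive own vertices doubles the step there, and one
reversal at k = 2 corrects even a when s is odd. For odd s the last own vertex has no partner to
interleave with. Three of its blocks are filled from `exists_balanced_triple`, which may skip one
label; the core edge 01 takes that label.

Apart from this exception, inner labels precede pendant labels, which precede core labels. Sorting
the blocks lexicographically (pairs in colex order, pendants by k and then a) makes the sums
monotone, and R ≥ 4 separates own from common sums (`own_lt_common`). -/

namespace LocalAntimagic

/-! ### Arithmetic of the labels of edges between own and common vertices. -/

section Numerics

/-- Three columns of `m` entries each with constant row sums, the first two permutations of
`{0, …, m - 1}` and the third an enumeration of `{0, …, m}` without one entry. -/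
theorem exists_balanced_triple (m : ℕ) : ∃ (y z w : ℕ → ℕ) (e c : ℕ), e ≤ m ∧
    (∀ i < m, y i < m) ∧ (∀ i < m, z i < m) ∧ (∀ i < m, w i ≤ m ∧ w i ≠ e) ∧
    (∀ i < m, ∀ j < m, y i = y j → i = j) ∧ (∀ i < m, ∀ j < m, z i = z j → i = j) ∧
    (∀ i < m, ∀ j < m, w i = w j → i = j) ∧ ∀ i < m, y i + z i + w i = c := by
  obtain ⟨h, rfl | rfl⟩ := Nat.even_or_odd' m
  -- For m = 2h three permutations of 0, ..., m - 1 cannot have constant row sums, as 3m(m - 1)/2 is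
  -- not divisible by m. Letting the third column run through 0, ..., m without h restores
  -- divisibility.
  · refine ⟨fun k => if k < h then h - 1 - k else 3 * h - 1 - k,
      fun k => if k < h then 2 * k else 2 * k + 1 - 2 * h,
      fun k => if k < h then 2 * h - k else 2 * h - 1 - k, h, 3 * h - 1, ?_, ?_, ?_, ?_, ?_, ?_, ?_, ?_⟩
    all_goals intros
    all_goals grind
  -- For odd m three permutations suffice, so the omitted entry is m itself.
  · refine ⟨fun k => if k % 2 = 0 then k / 2 else h + (k + 1) / 2,
      fun k => if k % 2 = 0 then h + k / 2 else (k - 1) / 2,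
      fun k => 2 * h - k, 2 * h + 1, 3 * h, ?_, ?_, ?_, ?_, ?_, ?_, ?_, ?_⟩
    all_goals intros
    all_goals grind

/-- The `i`-th entry of a column of length `m`, read upwards or downwards. -/
def direct (m : ℕ) (up : Prop) [Decidable up] (i : ℕ) : ℕ := if up then i else m - 1 - i

theorem direct_lt {m i : ℕ} (up : Prop) [Decidable up] (hi : i < m) : direct m up i < m := by
  unfold direct; split_ifs <;> omega

theorem direct_inj {m i j : ℕ} (up : Prop) [Decidable up] (hi : i < m) (hj : j < m)
    (h : direct m up i = direct m up j) : i = j := by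
  unfold direct at h; split_ifs at h <;> omega

theorem direct_sub {m i : ℕ} (up : Prop) [Decidable up] (hi : i < m) :
    (direct m up i : ℤ) - direct m up 0 = if up then (i : ℤ) else -i := by
  unfold direct; split_ifs <;> omega

/-- The last of an odd number `s` of columns of vertices. -/
def IsLeftover (s a : ℕ) : Prop := s % 2 = 1 ∧ a + 1 = s

instance (s a : ℕ) : Decidable (IsLeftover s a) := inferInstanceAs (Decidable (_ ∧ _))

/-- Labels (up to translation) of the edge from the `a`-th own vertex of the `i`-th copy to the
`k`-th common vertex. -/
def pendant (m s R : ℕ) (y z w : ℕ → ℕ) (i a k : ℕ) : ℕ :=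
  if IsLeftover s a then
    m * (s * k + a) + if k = 0 then y i else if k = 1 then z i else if k + 1 = R then w i
      else direct m (k % 2 = 0) i
  -- The columns 2t and 2t + 1 share an interval of 2m labels, one on the even and one on the odd
  -- positions, so both advance by 2 per copy.
  else if k = 0 then 2 * m * (a / 2) + 2 * i + a % 2
  else m * (s * k + a) + direct m (k % 2 = 0 ∧ ¬ (s % 2 = 1 ∧ a % 2 = 0 ∧ k = 2)) i

variable {m s R : ℕ} {y z w : ℕ → ℕ}

theorem le_pendant {i a k : ℕ} (h : k ≠ 0 ∨ IsLeftover s a) :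
    m * (s * k + a) ≤ pendant m s R y z w i a k := by
  unfold pendant
  split_ifs <;> first | omega | tauto

/-- Only an entry `w i = m` in the very last block can leave its block, which `h'` rules out; `h`
sets aside the interleaved columns. -/
theorem pendant_lt (hy : ∀ i < m, y i < m) (hz : ∀ i < m, z i < m) {i a k : ℕ} (hi : i < m)
    (hR : 3 ≤ R) (h : k ≠ 0 ∨ IsLeftover s a) (h' : a + 1 < s ∨ k + 1 ≠ R ∨ s % 2 = 0) :
    pendant m s R y z w i a k < m * (s * k + a + 1) := by
  have := hy i hi
  have := hz i hi
  rw [mul_add m, mul_one]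
  unfold pendant
  split_ifs with h1 <;> first | exact Nat.add_lt_add_left (direct_lt _ hi) _ | omega | skip
  · unfold IsLeftover at h1; omega
  · tauto

theorem pendant_le (hy : ∀ i < m, y i < m) (hz : ∀ i < m, z i < m) (hw : ∀ i < m, w i ≤ m)
    {i a k : ℕ} (hi : i < m) (h : k ≠ 0 ∨ IsLeftover s a) :
    pendant m s R y z w i a k ≤ m * (s * k + a + 1) := by
  have := hy i hi
  have := hz i hi
  have := hw i hi
  rw [mul_add m, mul_one]
  unfold pendant
  split_ifs with h1 <;> first | exact Nat.add_le_add_left (direct_lt _ hi).le _ | omega | skip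
  tauto

theorem pendant_zero {i a : ℕ} (h : ¬ IsLeftover s a) :
    pendant m s R y z w i a 0 = 2 * m * (a / 2) + 2 * i + a % 2 := by
  simp [pendant, h]

theorem two_mul_half_lt {a : ℕ} (ha : a < s) (h : ¬ IsLeftover s a) :
    2 * (a / 2 + 1) ≤ s := by
  unfold IsLeftover at h; omega

theorem pendant_zero_lt {i a : ℕ} (hi : i < m) (h : ¬ IsLeftover s a) :
    pendant m s R y z w i a 0 < m * (2 * (a / 2 + 1)) := by
  rw [pendant_zero h]
  have : m * (2 * (a / 2 + 1)) = 2 * m * (a / 2) + 2 * m := by ring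
  omega

theorem mul_row_le_pendant {i a k : ℕ} : m * (s * k) ≤ pendant m s R y z w i a k := by
  by_cases h : k ≠ 0 ∨ IsLeftover s a
  · exact le_trans (Nat.mul_le_mul_left _ (by omega)) (le_pendant h)
  · push Not at h
    simp [h.1]

theorem pendant_le_mul_row (hy : ∀ i < m, y i < m) (hz : ∀ i < m, z i < m)
    (hw : ∀ i < m, w i ≤ m) {i a k : ℕ} (hi : i < m) (ha : a < s) :
    pendant m s R y z w i a k ≤ m * (s * (k + 1)) := by
  by_cases h : k ≠ 0 ∨ IsLeftover s a
  · refine (pendant_le hy hz hw hi h).trans (Nat.mul_le_mul_left _ ?_)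
    rw [mul_add s]; omega
  · push Not at h
    obtain ⟨rfl, h⟩ := h
    refine (pendant_zero_lt hi h).le.trans (Nat.mul_le_mul_left _ ?_)
    simpa using two_mul_half_lt ha h

theorem pendant_lt_mul_row (hy : ∀ i < m, y i < m) (hz : ∀ i < m, z i < m)
    {i a k : ℕ} (hi : i < m) (ha : a < s) (hR : 3 ≤ R) (hk : k + 1 ≠ R) :
    pendant m s R y z w i a k < m * (s * (k + 1)) := by
  by_cases h : k ≠ 0 ∨ IsLeftover s a
  · refine (pendant_lt hy hz hi hR h (by tauto)).trans_le (Nat.mul_le_mul_left _ ?_)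
    rw [mul_add s]; omega
  · push Not at h
    obtain ⟨rfl, h⟩ := h
    refine (pendant_zero_lt hi h).trans_le (Nat.mul_le_mul_left _ ?_)
    simpa using two_mul_half_lt ha h

theorem pendant_lt_of_right_lt (hy : ∀ i < m, y i < m) (hz : ∀ i < m, z i < m)
    {i a k j b l : ℕ} (hi : i < m) (ha : a < s) (hR : 3 ≤ R) (hkl : k < l) (hl : l < R) :
    pendant m s R y z w i a k < pendant m s R y z w j b l :=
  (pendant_lt_mul_row hy hz hi ha hR (by omega)).trans_le <|
    (Nat.mul_le_mul_left _ (Nat.mul_le_mul_left _ hkl)).trans mul_row_le_pendant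

/-- Interleaved columns at k = 0 are comparable only within one copy, hence the common `i`. -/
theorem pendant_lt_of_middle_lt (hy : ∀ i < m, y i < m) (hz : ∀ i < m, z i < m)
    {i a b k : ℕ} (hi : i < m) (hab : a < b) (hb : b < s) (hR : 3 ≤ R) :
    pendant m s R y z w i a k < pendant m s R y z w i b k := by
  have ha : ¬ IsLeftover s a := by unfold IsLeftover; omega
  by_cases hk : k = 0
  · subst hk
    by_cases h : IsLeftover s b
    · refine (pendant_zero_lt hi ha).trans_le (le_trans (Nat.mul_le_mul_left _ ?_)
        (le_pendant (Or.inr h)))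
      unfold IsLeftover at h; omega
    · rw [pendant_zero ha, pendant_zero h]
      rcases (Nat.div_le_div_right (c := 2) hab.le).eq_or_lt with h2 | h2
      · rw [h2]; omega
      · have : 2 * m * (a / 2 + 1) ≤ 2 * m * (b / 2) := Nat.mul_le_mul_left _ h2
        rw [mul_add] at this
        omega
  · exact (pendant_lt hy hz hi hR (Or.inl hk) (by omega)).trans_le
      ((Nat.mul_le_mul_left _ (by omega)).trans (le_pendant (Or.inl hk)))

theorem pendant_inj (hy : ∀ i < m, y i < m) (hz : ∀ i < m, z i < m)
    (iy : ∀ i < m, ∀ j < m, y i = y j → i = j) (iz : ∀ i < m, ∀ j < m, z i = z j → i = j)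
    (iw : ∀ i < m, ∀ j < m, w i = w j → i = j)
    {i a k j b l : ℕ} (hi : i < m) (hj : j < m) (ha : a < s) (hb : b < s) (hk : k < R) (hl : l < R)
    (hR : 3 ≤ R) (h : pendant m s R y z w i a k = pendant m s R y z w j b l) :
    i = j ∧ a = b ∧ k = l := by
  have hkl : k = l := by
    rcases lt_trichotomy k l with h' | h' | h'
    · exact absurd h (pendant_lt_of_right_lt hy hz hi ha hR h' hl).ne
    · exact h'
    · exact absurd h (pendant_lt_of_right_lt hy hz hj hb hR h' hk).ne'
  subst hkl
  have key : ∀ {i j a b : ℕ}, i < m → j < m → b < s → a < b →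
      pendant m s R y z w i a k ≠ pendant m s R y z w j b k := by
    intro i j a b hi hj hb hab
    have ha : ¬ IsLeftover s a := by unfold IsLeftover; omega
    by_cases hk : k = 0
    · subst hk
      by_cases h : IsLeftover s b
      · refine ((pendant_zero_lt hi ha).trans_le (le_trans (Nat.mul_le_mul_left _ ?_)
          (le_pendant (Or.inr h)))).ne
        unfold IsLeftover at h; omega
      · rcases (Nat.div_le_div_right (c := 2) hab.le).eq_or_lt with h2 | h2
        · rw [pendant_zero ha, pendant_zero h, h2]; omega
        · refine ((pendant_zero_lt hi ha).trans_le (le_trans (Nat.mul_le_mul_left m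
            (Nat.mul_le_mul_left 2 h2)) ?_)).ne
          rw [pendant_zero h, ← mul_assoc, mul_comm m 2]
          omega
    · exact ((pendant_lt hy hz hi hR (Or.inl hk) (by omega)).trans_le
        ((Nat.mul_le_mul_left _ (by omega)).trans (le_pendant (Or.inl hk)))).ne
  have hab : a = b := by
    rcases lt_trichotomy a b with h' | h' | h'
    · exact absurd h (key hi hj hb h')
    · exact h'
    · exact absurd h.symm (key hj hi ha h')
  subst hab
  refine ⟨?_, rfl, rfl⟩
  unfold pendant at h
  split_ifs at h
  · exact iy i hi j hj (by omega)
  · exact iz i hi j hj (by omega)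
  · exact iw i hi j hj (by omega)
  · exact direct_inj _ hi hj (Nat.add_left_cancel h)
  · omega
  · exact direct_inj _ hi hj (Nat.add_left_cancel h)

/-- The value reserved for the core edge 01: for odd s the entry missed by `w`, for even s the first
value after all blocks. -/
theorem pendant_ne (hy : ∀ i < m, y i < m) (hz : ∀ i < m, z i < m) {e : ℕ}
    (hw : ∀ i < m, w i ≤ m ∧ (s % 2 = 1 → w i ≠ e)) (he : s % 2 = 0 → e = m)
    {i a k : ℕ} (hi : i < m) (ha : a < s) (hk : k < R) (hR : 3 ≤ R) :
    pendant m s R y z w i a k ≠ m * (s * R - 1) + e := by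
  by_cases h : k ≠ 0 ∨ IsLeftover s a
  · by_cases h' : a + 1 < s ∨ k + 1 ≠ R
    · refine ((pendant_lt hy hz hi hR h (by tauto)).trans_le
        ((Nat.mul_le_mul_left m ?_).trans (Nat.le_add_right _ _))).ne
      rcases h' with h' | h'
      · have := Nat.mul_le_mul_left s (show k + 1 ≤ R by omega)
        rw [mul_add] at this; omega
      · have := Nat.mul_le_mul_left s (show k + 2 ≤ R by omega)
        rw [mul_add] at this; omega
    · push Not at h'
      have h0 : s * k + a = s * R - 1 := by
        rw [← h'.2, mul_add]; omega
      by_cases hs : s % 2 = 0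
      · have := pendant_lt (w := w) hy hz hi hR h (Or.inr (Or.inr hs))
        rw [h0, mul_add] at this
        rw [he hs]; omega
      · have hl : IsLeftover s a := ⟨by omega, by omega⟩
        have := (hw i hi).2 (by omega)
        unfold pendant
        rw [if_pos hl, if_neg (by omega), if_neg (by omega), if_pos h'.2, h0]
        omega
  · push Not at h
    obtain ⟨rfl, h⟩ := h
    refine ((pendant_zero_lt hi h).trans_le ((Nat.mul_le_mul_left m ?_).trans
      (Nat.le_add_right _ _))).ne
    have := two_mul_half_lt ha h
    have := Nat.mul_le_mul_left s hR
    omega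

/-- The change per step of the sum of the labels of the edges `ab`, `b < s`. -/
def slope (s a : ℕ) : ℤ := ∑ b ∈ Finset.range s, if b = a then 0 else if (a + b) % 2 = 0 then 1 else -1

theorem alternating_sum (s : ℕ) :
    ∑ b ∈ Finset.range s, (if b % 2 = 0 then (1 : ℤ) else -1) = if s % 2 = 0 then 0 else 1 := by
  induction s with
  | zero => simp
  | succ n ih => rw [Finset.sum_range_succ, ih]; split_ifs <;> omega

theorem slope_eq {a : ℕ} (ha : a < s) :
    slope s a = (if a % 2 = 0 then 1 else -1) * (if s % 2 = 0 then 0 else 1) - 1 := by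
  have h : slope s a = ∑ b ∈ Finset.range s,
      ((if a % 2 = 0 then 1 else -1) * (if b % 2 = 0 then (1 : ℤ) else -1) -
        if b = a then 1 else 0) := by
    refine Finset.sum_congr rfl fun b _ => ?_
    split_ifs <;> omega
  rw [h, Finset.sum_sub_distrib, ← Finset.mul_sum, alternating_sum,
    Finset.sum_ite_eq' (Finset.range s) a, if_pos (Finset.mem_range.2 ha)]

/-- The compensation for the inner edges. The hypothesis on R ensures that the column k = 2 exists
and that the three special columns of the leftover vertex are distinct. -/
theorem sum_pendant_sub {c : ℕ} (hc : ∀ i < m, y i + z i + w i = c) (hR : 4 ≤ R)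
    (hsR : Even (s + R)) {i a : ℕ} (hi : i < m) (ha : a < s) :
    ∑ k ∈ Finset.range R, ((pendant m s R y z w i a k : ℤ) - pendant m s R y z w 0 a k) =
      - (i * slope s a) := by
  have hpar : s % 2 = R % 2 := by
    rw [Nat.even_iff] at hsR; omega
  rw [slope_eq ha]
  by_cases hl : IsLeftover s a
  -- An alternating row, corrected where the balanced triple replaces it. As R is odd, the
  -- alternating part i cancels against the corrections -i + i - i, and the triple has constant sum.
  · have h : ∀ k ∈ Finset.range R,
        ((pendant m s R y z w i a k : ℤ) - pendant m s R y z w 0 a k) =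
        (i : ℤ) * (if k % 2 = 0 then (1 : ℤ) else -1) + (if k = 0 then ((y i : ℤ) - y 0 - i) else 0)
          + (if k = 1 then ((z i : ℤ) - z 0 + i) else 0)
          + (if k = R - 1 then ((w i : ℤ) - w 0 - i) else 0) := by
      intro k hk
      have := hl.1
      have hd := direct_sub (k % 2 = 0) hi
      unfold pendant
      simp only [if_pos hl]
      push_cast
      split_ifs at hd ⊢ <;> omega
    have h0 := hc 0 (by omega)
    have h1 := hc i hi
    have := hl.1
    have := hl.2
    rw [Finset.sum_congr rfl h, Finset.sum_add_distrib, Finset.sum_add_distrib,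
      Finset.sum_add_distrib, ← Finset.mul_sum, alternating_sum, Finset.sum_ite_eq',
      Finset.sum_ite_eq', Finset.sum_ite_eq', if_pos (Finset.mem_range.2 (by omega : 0 < R)),
      if_pos (Finset.mem_range.2 (by omega : 1 < R)),
      if_pos (Finset.mem_range.2 (by omega : R - 1 < R)), if_neg (by omega : ¬ R % 2 = 0),
      if_pos (by omega : a % 2 = 0), if_neg (by omega : ¬ s % 2 = 0)]
    zify at h0 h1
    linarith
  -- An alternating row with an extra step at k = 0 from interleaving, and a change from +1 to -1 at
  -- k = 2 where that column is reversed.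
  · have h : ∀ k ∈ Finset.range R,
        ((pendant m s R y z w i a k : ℤ) - pendant m s R y z w 0 a k) =
        (i : ℤ) * ((if k % 2 = 0 then (1 : ℤ) else -1) + (if k = 0 then 1 else 0)
          + (if k = 2 then (if s % 2 = 1 ∧ a % 2 = 0 then -2 else 0) else 0)) := by
      intro k hk
      have hd := direct_sub (k % 2 = 0 ∧ ¬ (s % 2 = 1 ∧ a % 2 = 0 ∧ k = 2)) hi
      unfold pendant
      simp only [if_neg hl]
      push_cast
      split_ifs at hd ⊢ <;> omega
    rw [Finset.sum_congr rfl h, ← Finset.mul_sum, Finset.sum_add_distrib, Finset.sum_add_distrib,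
      alternating_sum, Finset.sum_ite_eq', Finset.sum_ite_eq', if_pos (Finset.mem_range.2 (by omega : 0 < R)),
      if_pos (Finset.mem_range.2 (by omega : 2 < R))]
    rw [← mul_neg]
    congr 1
    split_ifs <;> omega

end Numerics

/-! ### Book graphs, their edges, and a criterion for the chromatic number. -/

section BookGraph

/-- Copies, indexed by `ι`, of the complete graph on `β ⊕ γ` that have the vertices in `γ` in
common. -/
def bookGraph (ι β γ : Type*) : SimpleGraph (ι × β ⊕ γ) where
  Adj u v := u ≠ v ∧ ∀ p q, u = Sum.inl p → v = Sum.inl q → p.1 = q.1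
  symm := ⟨fun _ _ h => ⟨h.1.symm, fun p q hp hq => (h.2 q p hq hp).symm⟩⟩
  loopless := ⟨fun _ h => h.1 rfl⟩

variable {ι β γ : Type*}

theorem bookGraph_adj_inl_inl {i j : ι} {a b : β} :
    (bookGraph ι β γ).Adj (Sum.inl (i, a)) (Sum.inl (j, b)) ↔ i = j ∧ a ≠ b := by
  simp only [bookGraph]
  constructor
  · rintro ⟨h, h'⟩
    have := h' _ _ rfl rfl
    simp only at this
    subst this
    exact ⟨rfl, by rintro rfl; exact h rfl⟩
  · rintro ⟨rfl, h⟩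
    exact ⟨by simpa using h, by rintro _ _ ⟨⟩ ⟨⟩; rfl⟩

theorem bookGraph_adj_inl_inr {p : ι × β} {k : γ} :
    (bookGraph ι β γ).Adj (Sum.inl p) (Sum.inr k) := by
  simp [bookGraph]

theorem bookGraph_adj_inr_inl {p : ι × β} {k : γ} :
    (bookGraph ι β γ).Adj (Sum.inr k) (Sum.inl p) := by
  simp [bookGraph]

theorem bookGraph_adj_inr_inr {k l : γ} :
    (bookGraph ι β γ).Adj (Sum.inr k) (Sum.inr l) ↔ k ≠ l := by
  simp [bookGraph]

open scoped Classical in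
theorem vertexSum_eq_sum_ite {V : Type*} [Fintype V] (G : SimpleGraph V) (g : Sym2 V → ℕ) (v : V) :
    vertexSum G g v = ∑ u, if G.Adj u v then g s(u, v) else 0 := by
  rw [vertexSum, ← Finset.sum_filter]
  refine Finset.sum_congr ?_ fun _ _ => rfl
  ext u
  simp [SimpleGraph.adj_comm]

theorem card_le_colorNumber [Fintype ι] [Fintype β] [Fintype γ] [Nonempty ι]
    {g : Sym2 (ι × β ⊕ γ) → ℕ} (hg : IsLocalAntimagicLabeling (bookGraph ι β γ) g) :
    Fintype.card β + Fintype.card γ ≤ colorNumber (bookGraph ι β γ) g := by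
  obtain ⟨i⟩ := ‹Nonempty ι›
  let e : β ⊕ γ → ι × β ⊕ γ := Sum.map (fun b => (i, b)) id
  have he : ∀ x y, x ≠ y → (bookGraph ι β γ).Adj (e x) (e y) := by
    rintro (a | k) (b | l) h
    · exact bookGraph_adj_inl_inl.2 ⟨rfl, by simpa using h⟩
    · exact bookGraph_adj_inl_inr
    · exact bookGraph_adj_inr_inl
    · exact bookGraph_adj_inr_inr.2 (by simpa using h)
  have hinj : Function.Injective fun x => vertexSum (bookGraph ι β γ) g (e x) := by
    intro x y h
    by_contra hxy
    exact hg.2 _ _ (he x y hxy) h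
  rw [← Fintype.card_sum, ← Nat.card_eq_fintype_card, ← Set.ncard_univ,
    ← Set.ncard_image_of_injective _ hinj]
  refine Set.ncard_le_ncard ?_ (Set.finite_range _)
  rintro _ ⟨x, -, rfl⟩
  exact ⟨e x, rfl⟩

/-- The symmetric function on pairs of vertices given by labels of edges inside a copy, of edges
between own and common vertices, and of edges between common vertices. -/
def bookLabel [LinearOrder ι] (I : ι → β → β → ℕ) (P : ι → β → γ → ℕ) (K : γ → γ → ℕ)
    (hI : ∀ i a b, I i a b = I i b a) (hK : ∀ k l, K k l = K l k) : Sym2 (ι × β ⊕ γ) → ℕ :=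
  Sym2.lift ⟨fun
    -- Pairs with i ≠ j are not edges; `min` merely provides a symmetric default.
    | Sum.inl (i, a), Sum.inl (j, b) => I (min i j) a b
    | Sum.inl (i, a), Sum.inr k => P i a k
    | Sum.inr k, Sum.inl (i, a) => P i a k
    | Sum.inr k, Sum.inr l => K k l, by
    rintro (⟨i, a⟩ | k) (⟨j, b⟩ | l)
    · simp only [hI _ a b, min_comm]
    · rfl
    · rfl
    · exact hK k l⟩

section

variable [LinearOrder ι] {I : ι → β → β → ℕ} {P : ι → β → γ → ℕ} {K : γ → γ → ℕ}
  {hI : ∀ i a b, I i a b = I i b a} {hK : ∀ k l, K k l = K l k}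

theorem bookLabel_inl_inl {i : ι} {a b : β} :
    bookLabel I P K hI hK s(Sum.inl (i, a), Sum.inl (i, b)) = I i a b := by
  simp [bookLabel]

theorem bookLabel_inl_inr {i : ι} {a : β} {k : γ} :
    bookLabel I P K hI hK s(Sum.inl (i, a), Sum.inr k) = P i a k := rfl

theorem bookLabel_inr_inl {i : ι} {a : β} {k : γ} :
    bookLabel I P K hI hK s(Sum.inr k, Sum.inl (i, a)) = P i a k := rfl

theorem bookLabel_inr_inr {k l : γ} :
    bookLabel I P K hI hK s(Sum.inr k, Sum.inr l) = K k l := rfl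

variable [Fintype ι] [Fintype β] [Fintype γ]

theorem vertexSum_bookLabel_inl [DecidableEq β] (i : ι) (a : β) :
    vertexSum (bookGraph ι β γ) (bookLabel I P K hI hK) (Sum.inl (i, a)) =
      (∑ b, if b = a then 0 else I i b a) + ∑ k, P i a k := by
  classical
  rw [vertexSum_eq_sum_ite, Fintype.sum_sum_type, Fintype.sum_prod_type, Fintype.sum_eq_single i]
  · congr 1
    · refine Finset.sum_congr rfl fun b _ => ?_
      by_cases h : b = a <;> simp [bookGraph_adj_inl_inl, h, bookLabel_inl_inl]
    · refine Finset.sum_congr rfl fun k _ => ?_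
      rw [if_pos bookGraph_adj_inr_inl, bookLabel_inr_inl]
  · intro j hj
    refine Finset.sum_eq_zero fun b _ => ?_
    rw [if_neg]
    simp [bookGraph_adj_inl_inl, hj]

theorem vertexSum_bookLabel_inr [DecidableEq γ] (k : γ) :
    vertexSum (bookGraph ι β γ) (bookLabel I P K hI hK) (Sum.inr k) =
      (∑ i, ∑ a, P i a k) + ∑ l, if l = k then 0 else K l k := by
  classical
  rw [vertexSum_eq_sum_ite, Fintype.sum_sum_type, Fintype.sum_prod_type]
  congr 1
  · refine Finset.sum_congr rfl fun i _ => Finset.sum_congr rfl fun a _ => ?_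
    rw [if_pos bookGraph_adj_inl_inr, bookLabel_inl_inr]
  · refine Finset.sum_congr rfl fun l _ => ?_
    by_cases h : l = k <;> simp [bookGraph_adj_inr_inr, h, bookLabel_inr_inr]

end

/-- The edges of `bookGraph (Fin m) (Fin s) (Fin R)`. -/
abbrev BookEdge (m s R : ℕ) : Type :=
  (Fin m × (Σ b : Fin s, Fin b)) ⊕ (Fin m × Fin s × Fin R) ⊕ (Σ l : Fin R, Fin l)

/-- The edge with a given index. -/
def BookEdge.toSym2 {m s R : ℕ} : BookEdge m s R → Sym2 (Fin m × Fin s ⊕ Fin R)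
  | Sum.inl (i, ⟨b, a⟩) => s(Sum.inl (i, ⟨a, a.2.trans b.2⟩), Sum.inl (i, b))
  | Sum.inr (Sum.inl (i, a, k)) => s(Sum.inl (i, a), Sum.inr k)
  | Sum.inr (Sum.inr ⟨l, k⟩) => s(Sum.inr ⟨k, k.2.trans l.2⟩, Sum.inr l)

theorem range_toSym2 {m s R : ℕ} :
    Set.range (BookEdge.toSym2 (m := m) (s := s) (R := R)) =
      (bookGraph (Fin m) (Fin s) (Fin R)).edgeSet := by
  ext e
  constructor
  · rintro ⟨⟨i, ⟨b, a⟩⟩ | ⟨i, a, k⟩ | ⟨l, k⟩, rfl⟩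
    · exact bookGraph_adj_inl_inl.2 ⟨rfl, Fin.ne_of_lt a.2⟩
    · exact bookGraph_adj_inl_inr
    · exact bookGraph_adj_inr_inr.2 (Fin.ne_of_lt k.2)
  · induction e with
    | _ u v =>
      rw [SimpleGraph.mem_edgeSet]
      rcases u with ⟨i, a⟩ | k <;> rcases v with ⟨j, b⟩ | l
      · rw [bookGraph_adj_inl_inl]
        rintro ⟨rfl, h⟩
        rcases lt_or_gt_of_ne h with h | h
        · exact ⟨Sum.inl (i, ⟨b, ⟨a, h⟩⟩), rfl⟩
        · exact ⟨Sum.inl (i, ⟨a, ⟨b, h⟩⟩), Sym2.eq_swap⟩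
      · exact fun _ => ⟨Sum.inr (Sum.inl (i, a, l)), rfl⟩
      · exact fun _ => ⟨Sum.inr (Sum.inl (j, b, k)), Sym2.eq_swap⟩
      · rw [bookGraph_adj_inr_inr]
        intro h
        rcases lt_or_gt_of_ne h with h | h
        · exact ⟨Sum.inr (Sum.inr ⟨l, ⟨k, h⟩⟩), rfl⟩
        · exact ⟨Sum.inr (Sum.inr ⟨k, ⟨l, h⟩⟩), Sym2.eq_swap⟩

theorem card_sigma_fin (n : ℕ) : Fintype.card (Σ b : Fin n, Fin b) = n.choose 2 := by
  simp [Fin.sum_univ_eq_sum_range fun i => i, Finset.sum_range_id, Nat.choose_two_right]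

theorem card_bookEdge (m s R : ℕ) :
    Fintype.card (BookEdge m s R) = m * s.choose 2 + m * (s * R) + R.choose 2 := by
  rw [Fintype.card_sum, Fintype.card_sum, Fintype.card_prod, card_sigma_fin, card_sigma_fin]
  simp [add_assoc]

theorem bijOn_edgeSet_of_injective {m s R : ℕ} {g : Sym2 (Fin m × Fin s ⊕ Fin R) → ℕ}
    (hinj : Function.Injective fun e : BookEdge m s R => g e.toSym2)
    (hpos : ∀ e : BookEdge m s R, 1 ≤ g e.toSym2)
    (hle : ∀ e : BookEdge m s R, g e.toSym2 ≤ Fintype.card (BookEdge m s R)) :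
    Set.BijOn g (bookGraph (Fin m) (Fin s) (Fin R)).edgeSet
      (Set.Icc 1 (bookGraph (Fin m) (Fin s) (Fin R)).edgeSet.ncard) := by
  have hcard : (Set.range (BookEdge.toSym2 (m := m) (s := s) (R := R))).ncard =
      Fintype.card (BookEdge m s R) := by
    -- Distinct labels force distinct edges, so the indices count the edges.
    rw [← Set.image_univ, Set.ncard_image_of_injective _ (Function.Injective.of_comp hinj),
      Set.ncard_univ, Nat.card_eq_fintype_card]
  rw [← range_toSym2, hcard]
  have hmaps : Set.MapsTo g (Set.range (BookEdge.toSym2 (m := m) (s := s) (R := R)))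
      (Set.Icc 1 (Fintype.card (BookEdge m s R))) := by
    rintro _ ⟨e, rfl⟩
    exact ⟨hpos e, hle e⟩
  have hinjOn : Set.InjOn g (Set.range (BookEdge.toSym2 (m := m) (s := s) (R := R))) := by
    rintro _ ⟨e, rfl⟩ _ ⟨e', rfl⟩ h
    rw [hinj h]
  refine ⟨hmaps, hinjOn, ?_⟩
  refine (Set.eq_of_subset_of_ncard_le hmaps.image_subset ?_ (Set.finite_Icc _ _)).ge
  rw [hinjOn.ncard_image, hcard, Set.ncard_eq_toFinset_card']
  simp

theorem localAntimagicChromaticNumber_bookGraph_of_labels {m s R : ℕ} [NeZero m]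
    {I : Fin m → Fin s → Fin s → ℕ}
    {P : Fin m → Fin s → Fin R → ℕ} {K : Fin R → Fin R → ℕ}
    (hI : ∀ i a b, I i a b = I i b a) (hK : ∀ k l, K k l = K l k)
    (hinj : Function.Injective fun e : BookEdge m s R => bookLabel I P K hI hK e.toSym2)
    (hpos : ∀ e : BookEdge m s R, 1 ≤ bookLabel I P K hI hK e.toSym2)
    (hle : ∀ e : BookEdge m s R,
      bookLabel I P K hI hK e.toSym2 ≤ Fintype.card (BookEdge m s R))
    {c : Fin s → ℕ} (hc : ∀ i a, (∑ b, if b = a then 0 else I i b a) + ∑ k, P i a k = c a)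
    (hcinj : Function.Injective c) {d : Fin R → ℕ}
    (hd : ∀ k, (∑ i, ∑ a, P i a k) + (∑ l, if l = k then 0 else K l k) = d k)
    (hdinj : Function.Injective d) (hcd : ∀ a k, c a < d k) :
    localAntimagicChromaticNumber (bookGraph (Fin m) (Fin s) (Fin R)) = ((s + R : ℕ) : ℕ∞) := by
  have hsl : ∀ i a, vertexSum (bookGraph (Fin m) (Fin s) (Fin R)) (bookLabel I P K hI hK)
      (Sum.inl (i, a)) = c a := fun i a => (vertexSum_bookLabel_inl i a).trans (hc i a)
  have hsr : ∀ k, vertexSum (bookGraph (Fin m) (Fin s) (Fin R)) (bookLabel I P K hI hK)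
      (Sum.inr k) = d k := fun k => (vertexSum_bookLabel_inr k).trans (hd k)
  have hg : IsLocalAntimagicLabeling (bookGraph (Fin m) (Fin s) (Fin R))
      (bookLabel I P K hI hK) := by
    refine ⟨bijOn_edgeSet_of_injective hinj hpos hle, ?_⟩
    rintro (⟨i, a⟩ | k) (⟨j, b⟩ | l) h
    · rw [hsl, hsl]
      exact hcinj.ne (bookGraph_adj_inl_inl.1 h).2
    · rw [hsl, hsr]
      exact (hcd a l).ne
    · rw [hsl, hsr]
      exact (hcd b k).ne'
    · rw [hsr, hsr]
      exact hdinj.ne (bookGraph_adj_inr_inr.1 h)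
  apply le_antisymm
  · refine (iInf_le _ ⟨_, hg⟩).trans (Nat.cast_le.2 ?_)
    have hsub : Set.range (vertexSum (bookGraph (Fin m) (Fin s) (Fin R))
        (bookLabel I P K hI hK)) ⊆ Set.range (Sum.elim c d) := by
      rintro _ ⟨⟨i, a⟩ | k, rfl⟩
      · exact ⟨Sum.inl a, (hsl i a).symm⟩
      · exact ⟨Sum.inr k, (hsr k).symm⟩
    refine (Set.ncard_le_ncard hsub (Set.finite_range _)).trans ?_
    rw [← Set.image_univ]
    refine (Set.ncard_image_le Set.finite_univ).trans ?_
    rw [Set.ncard_univ, Nat.card_eq_fintype_card]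
    simp
  · refine le_iInf fun g => Nat.cast_le.2 ?_
    simpa using card_le_colorNumber g.2

end BookGraph

/-! ### Colexicographic ranking of pairs. -/

section Colex

/-- The rank of a pair of distinct natural numbers in the colexicographic order. -/
def colex (a b : ℕ) : ℕ := (max a b).choose 2 + min a b

theorem colex_comm (a b : ℕ) : colex a b = colex b a := by
  rw [colex, colex, max_comm, min_comm]

theorem colex_of_lt {a b : ℕ} (h : a < b) : colex a b = b.choose 2 + a := by
  rw [colex, max_eq_right h.le, min_eq_left h.le]

theorem choose_two_add_le {b c : ℕ} (h : b < c) : b.choose 2 + b ≤ c.choose 2 := by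
  have h1 : (b + 1).choose 2 = b + b.choose 2 := by
    rw [Nat.choose_succ_succ' b 1, Nat.choose_one_right]
  have := Nat.choose_le_choose 2 (show b + 1 ≤ c from h)
  omega

theorem colex_lt_choose {a b s : ℕ} (h : a ≠ b) (ha : a < s) (hb : b < s) :
    colex a b < s.choose 2 := by
  wlog hab : a < b generalizing a b
  · rw [colex_comm]
    exact this h.symm hb ha (by omega)
  · rw [colex_of_lt hab]
    have := choose_two_add_le hb
    omega

theorem colex_inj {a b c d : ℕ} (hab : a < b) (hcd : c < d) (h : colex a b = colex c d) :
    a = c ∧ b = d := by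
  rw [colex_of_lt hab, colex_of_lt hcd] at h
  rcases lt_trichotomy b d with h' | rfl | h'
  · have := choose_two_add_le h'
    omega
  · exact ⟨by omega, rfl⟩
  · have := choose_two_add_le h'
    omega

theorem colex_lt_colex {l a b : ℕ} (ha : l ≠ a) (hb : l ≠ b) (hab : a < b) :
    colex l a < colex l b := by
  rcases lt_or_gt_of_ne ha with ha | ha <;> rcases lt_or_gt_of_ne hb with hb | hb
  · rw [colex_of_lt ha, colex_of_lt hb]
    have := choose_two_add_le hab
    omega
  · omega
  · rw [colex_comm, colex_of_lt ha, colex_of_lt hb]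
    have := choose_two_add_le hb
    omega
  · rw [colex_comm, colex_of_lt ha, colex_comm, colex_of_lt hb]
    omega

/-- The transposition of a and b matches the terms; the pair ab meets itself by symmetry. -/
theorem sum_ite_le_sum_ite {α : Type*} [Fintype α] [DecidableEq α] {F : α → α → ℕ}
    (hF : ∀ a b, F a b = F b a) {a b : α} (h : ∀ l, l ≠ a → l ≠ b → F l a ≤ F l b) :
    (∑ l, if l = a then 0 else F l a) ≤ ∑ l, if l = b then 0 else F l b := by
  rw [← Equiv.sum_comp (Equiv.swap a b) fun l => if l = b then 0 else F l b]
  refine Finset.sum_le_sum fun l _ => ?_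
  by_cases hla : l = a
  · simp [hla]
  · rw [if_neg hla]
    by_cases hlb : l = b
    · subst hlb
      rw [Equiv.swap_apply_right, if_neg (Ne.symm hla), hF]
    · rw [Equiv.swap_apply_of_ne_of_ne hla hlb, if_neg hlb]
      exact h l hla hlb

theorem sum_ite_const {n : ℕ} (a : Fin n) (x : ℕ) :
    (∑ b, if b = a then 0 else x) = (n - 1) * x := by
  simp [Finset.sum_ite, Finset.filter_ne']

end Colex

/-! ### The complete labeling and its vertex sums. -/

section Assembly

/-- Labels of the edges inside the copies. -/
def innerLabel (m i a b : ℕ) : ℕ := m * colex a b + direct m ((a + b) % 2 = 0) i + 1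

theorem innerLabel_comm (m i a b : ℕ) : innerLabel m i a b = innerLabel m i b a := by
  simp only [innerLabel, colex_comm, add_comm a b]

/-- Labels of the edges between the common vertices; `e` is the only label below the others. -/
def coreLabel (T e k l : ℕ) : ℕ := (if colex k l = 0 then e else T + colex k l) + 1

theorem coreLabel_comm (T e k l : ℕ) : coreLabel T e k l = coreLabel T e l k := by
  simp only [coreLabel, colex_comm]

variable {m s R : ℕ}

theorem innerLabel_le {i a b : ℕ} (hi : i < m) (h : a ≠ b) (ha : a < s) (hb : b < s) :
    innerLabel m i a b ≤ m * s.choose 2 := by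
  have h1 := Nat.mul_le_mul_left m (colex_lt_choose h ha hb)
  have h2 := direct_lt ((a + b) % 2 = 0) hi
  rw [Nat.succ_eq_add_one, mul_add, mul_one] at h1
  unfold innerLabel
  omega

theorem mul_add_inj {u v o p : ℕ} (ho : o < m) (hp : p < m) (h : m * u + o = m * v + p) :
    u = v ∧ o = p := by
  rcases lt_trichotomy u v with h' | rfl | h'
  · have := Nat.mul_le_mul_left m (show u + 1 ≤ v from h')
    rw [mul_add] at this
    omega
  · exact ⟨rfl, by omega⟩
  · have := Nat.mul_le_mul_left m (show v + 1 ≤ u from h')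
    rw [mul_add] at this
    omega

theorem innerLabel_inj {i j a b c d : ℕ} (hi : i < m) (hj : j < m) (hab : a < b) (hcd : c < d)
    (h : innerLabel m i a b = innerLabel m j c d) : i = j ∧ a = c ∧ b = d := by
  obtain ⟨h1, h2⟩ := mul_add_inj (direct_lt _ hi) (direct_lt _ hj) (Nat.succ_injective h)
  obtain ⟨rfl, rfl⟩ := colex_inj hab hcd h1
  exact ⟨direct_inj _ hi hj h2, rfl, rfl⟩

theorem innerLabel_le_innerLabel {i l a b : ℕ} (hi : i < m) (ha : l ≠ a) (hb : l ≠ b)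
    (hab : a < b) : innerLabel m i l a ≤ innerLabel m i l b := by
  have h1 := Nat.mul_le_mul_left m (colex_lt_colex ha hb hab)
  have h2 := direct_lt ((l + a) % 2 = 0) hi
  rw [Nat.succ_eq_add_one, mul_add, mul_one] at h1
  unfold innerLabel
  omega

theorem sum_innerLabel_sub {i : ℕ} (hi : i < m) (a : Fin s) :
    ((∑ b : Fin s, if b = a then 0 else innerLabel m i b a : ℕ) : ℤ) -
      (∑ b : Fin s, if b = a then 0 else innerLabel m 0 b a : ℕ) = i * slope s a := by
  rw [slope, ← Fin.sum_univ_eq_sum_range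
    (fun b => if b = (a : ℕ) then (0 : ℤ) else if (a + b) % 2 = 0 then 1 else -1), Finset.mul_sum]
  push_cast
  rw [← Finset.sum_sub_distrib]
  refine Finset.sum_congr rfl fun b _ => ?_
  by_cases h : b = a
  · simp [h]
  · rw [if_neg h, if_neg h, if_neg (Fin.val_ne_of_ne h)]
    have := direct_sub (((b : ℕ) + a) % 2 = 0) hi
    unfold innerLabel
    push_cast
    rw [add_comm (a : ℕ) b]
    split_ifs at this ⊢ <;> linarith

theorem coreLabel_inj {T e a b c d : ℕ} (he : e ≤ T) (hab : a < b) (hcd : c < d)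
    (h : coreLabel T e a b = coreLabel T e c d) : a = c ∧ b = d := by
  refine colex_inj hab hcd ?_
  unfold coreLabel at h
  split_ifs at h <;> omega

theorem coreLabel_le_coreLabel {T e l a b : ℕ} (he : e ≤ T) (ha : l ≠ a) (hb : l ≠ b)
    (hab : a < b) : coreLabel T e l a ≤ coreLabel T e l b := by
  have := colex_lt_colex ha hb hab
  unfold coreLabel
  split_ifs <;> omega

theorem lt_coreLabel {T e : ℕ} (he : e ≤ T) (k l : ℕ) : e < coreLabel T e k l := by
  unfold coreLabel
  split_ifs <;> omega

theorem coreLabel_le {T e k l : ℕ} (he : e ≤ T) (h : k ≠ l) (hk : k < R) (hl : l < R) :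
    coreLabel T e k l ≤ T + R.choose 2 := by
  have := colex_lt_choose h hk hl
  unfold coreLabel
  split_ifs <;> omega

theorem ne_coreLabel {T e x : ℕ} (hx : x ≤ T) (hxe : x ≠ e) (k l : ℕ) :
    x + 1 ≠ coreLabel T e k l := by
  unfold coreLabel
  split_ifs <;> omega

/-- The terms in A compare because ms ≥ s. What remains is essentially (R - 1)msR against msR(R +
1)/2, where R ≥ 4 gives enough room. -/
theorem own_lt_common {A B S : ℕ} (hm : 0 < m) (hs : 0 < s) (hR : 4 ≤ R) (hsR : Even (s + R))
    (hS : S * 2 = R * (R + 1)) (hB : B + m = m * (s * R)) :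
    (s - 1) * A + (R * A + m * s * S + R) < m * (s * (A + 1)) + (R - 1) * (A + B + 1) := by
  obtain ⟨s, rfl⟩ : ∃ t, s = t + 1 := ⟨s - 1, by omega⟩
  obtain ⟨R, rfl⟩ : ∃ t, R = t + 1 := ⟨R - 1, by omega⟩
  simp only [Nat.add_sub_cancel]
  obtain ⟨B', hB'⟩ : ∃ x : ℤ, x = B := ⟨_, rfl⟩
  have h1 : (s : ℤ) * A + A ≤ m * (s + 1) * A := by
    have : (0 : ℤ) ≤ (m - 1) * ((s + 1) * A) := by
      apply mul_nonneg <;> [(have : (1 : ℤ) ≤ m := by exact_mod_cast hm); positivity]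
      linarith
    nlinarith
  have h2 : 2 * (R : ℤ) * m + 2 < m * (s + 1) * (R * (R - 1)) := by
    have hm' : (1 : ℤ) ≤ m := by exact_mod_cast hm
    -- After the shift this is the original R = 4, where the estimate fails for a single own vertex;
    -- parity excludes that case.
    by_cases h3 : R = 3
    · subst h3
      have : 1 ≤ s := by
        rcases Nat.eq_zero_or_pos s with rfl | h
        · exact absurd hsR (by decide)
        · exact h
      have h' : (1 : ℤ) ≤ s := by exact_mod_cast this
      push_cast
      nlinarith
    · have h4 : (4 : ℤ) ≤ R := by exact_mod_cast (show 4 ≤ R by omega)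
      have h5 : (m : ℤ) * (R * (R - 1)) ≤ m * (s + 1) * (R * (R - 1)) := by
        have : (0 : ℤ) ≤ m * s * (R * (R - 1)) := by
          apply mul_nonneg (by positivity)
          nlinarith
        nlinarith
      have h6 : (R : ℤ) * m * 3 ≤ m * (R * (R - 1)) := by
        have : (0 : ℤ) ≤ m * R * (R - 4) := by
          apply mul_nonneg (by positivity); linarith
        nlinarith
      nlinarith
  zify at hS hB ⊢
  have hB2 : (B : ℤ) = m * ((s + 1) * (R + 1)) - m := by linarith
  have hS2 : (m : ℤ) * (s + 1) * S * 2 = m * (s + 1) * ((R + 1) * (R + 1 + 1)) := by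
    rw [mul_assoc, hS]
  rw [hB2]
  nlinarith

theorem localAntimagicChromaticNumber_bookGraph (m s R : ℕ) (hm : 0 < m) (hs : 0 < s) (hR : 4 ≤ R)
    (hsR : Even (s + R)) :
    localAntimagicChromaticNumber (bookGraph (Fin m) (Fin s) (Fin R)) = ((s + R : ℕ) : ℕ∞) := by
  have : NeZero m := ⟨hm.ne'⟩
  obtain ⟨y, z, w, e, c, he, hsk, hy, hz, hw, iy, iz, iw, hc⟩ : ∃ (y z w : ℕ → ℕ) (e c : ℕ),
      e ≤ m ∧ (s % 2 = 0 → e = m) ∧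
      (∀ i < m, y i < m) ∧ (∀ i < m, z i < m) ∧ (∀ i < m, w i ≤ m ∧ (s % 2 = 1 → w i ≠ e)) ∧
      (∀ i < m, ∀ j < m, y i = y j → i = j) ∧ (∀ i < m, ∀ j < m, z i = z j → i = j) ∧
      (∀ i < m, ∀ j < m, w i = w j → i = j) ∧ ∀ i < m, y i + z i + w i = c := by
    obtain ⟨y, z, w, e, c, he, hy, hz, hw, iy, iz, iw, hc⟩ := exists_balanced_triple m
    -- For even s there is no leftover vertex; e = m makes E = T, so the core labels are
    -- consecutive.
    refine ⟨y, z, w, if s % 2 = 0 then m else e, c, by split_ifs <;> omega, fun h => if_pos h,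
      hy, hz, fun i hi => ⟨(hw i hi).1, fun h => ?_⟩, iy, iz, iw, hc⟩
    rw [if_neg (by omega)]
    exact (hw i hi).2
  have hw' : ∀ i < m, w i ≤ m := fun i hi => (hw i hi).1
  have hR3 : 3 ≤ R := by omega
  have hB : m * (s * R - 1) + m = m * (s * R) := by
    have : 0 < s * R := by positivity
    rw [← Nat.mul_succ]
    congr 1
    omega
  set A := m * s.choose 2 with hA
  set p := pendant m s R y z w with hp
  set T := A + m * (s * R) with hT
  set E := A + (m * (s * R - 1) + e) with hE
  have hET : E ≤ T := by omega
  have hpT : ∀ {i a k : ℕ}, i < m → a < s → k < R → p i a k ≤ m * (s * R) := fun hi ha hk =>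
    (pendant_le_mul_row hy hz hw' hi ha).trans
      (Nat.mul_le_mul_left _ (Nat.mul_le_mul_left _ hk))
  have hpE : ∀ {i a k : ℕ}, i < m → a < s → k < R → A + p i a k ≠ E := fun hi ha hk h =>
    pendant_ne hy hz hw hsk hi ha hk hR3 (Nat.add_left_cancel h)
  have hc2 : 1 ≤ R.choose 2 := Nat.choose_pos (by omega)
  refine localAntimagicChromaticNumber_bookGraph_of_labels
    (I := fun i a b => innerLabel m i a b) (P := fun i a k => A + p i a k + 1)
    (K := fun k l => coreLabel T E k l) (fun i a b => innerLabel_comm m i a b)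
    (fun k l => coreLabel_comm T E k l) ?_ ?_ ?_
    (c := fun a => (∑ b, if b = a then 0 else innerLabel m 0 b a) +
      ∑ k : Fin R, (A + p 0 a k + 1)) ?_ ?_ (fun k => rfl) ?_ ?_
  · have hIP : ∀ (x : Fin m × (Σ b : Fin s, Fin b)) (i : Fin m) (a : Fin s) (k : Fin R),
        innerLabel m x.1 x.2.2 x.2.1 ≠ A + p i a k + 1 := by
      rintro ⟨i, b, a⟩ j c k
      dsimp only
      have := innerLabel_le i.2 a.2.ne (a.2.trans b.2) b.2
      omega
    have hIK : ∀ (x : Fin m × (Σ b : Fin s, Fin b)) (k l : ℕ),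
        innerLabel m x.1 x.2.2 x.2.1 ≠ coreLabel T E k l := by
      rintro ⟨i, b, a⟩ k l
      dsimp only
      have := innerLabel_le i.2 a.2.ne (a.2.trans b.2) b.2
      have := lt_coreLabel hET k l
      omega
    have hPK : ∀ (i : Fin m) (a : Fin s) (j : Fin R) (k l : ℕ),
        A + p i a j + 1 ≠ coreLabel T E k l := fun i a j k l =>
      ne_coreLabel (Nat.add_le_add_left (hpT i.2 a.2 j.2) A) (hpE i.2 a.2 j.2) k l
    rintro (⟨i, b, a⟩ | ⟨i, a, k⟩ | ⟨l, k⟩) (⟨j, b', a'⟩ | ⟨j, a', k'⟩ | ⟨l', k'⟩) h <;>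
      simp only [BookEdge.toSym2, bookLabel_inl_inl, bookLabel_inl_inr, bookLabel_inr_inr] at h
    · obtain ⟨h1, h2, h3⟩ := innerLabel_inj i.2 j.2 a.2 a'.2 h
      obtain rfl := Fin.ext h1
      obtain rfl := Fin.ext h3
      obtain rfl := Fin.ext h2
      rfl
    · exact absurd h (hIP (i, ⟨b, a⟩) j a' k')
    · exact absurd h (hIK (i, ⟨b, a⟩) _ _)
    · exact absurd h.symm (hIP (j, ⟨b', a'⟩) i a k)
    · obtain ⟨h1, h2, h3⟩ := pendant_inj hy hz iy iz iw i.2 j.2 a.2 a'.2 k.2 k'.2 hR3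
        (Nat.add_left_cancel (Nat.succ_injective h))
      rw [Fin.ext h1, Fin.ext h2, Fin.ext h3]
    · exact absurd h (hPK i a k _ _)
    · exact absurd h.symm (hIK (j, ⟨b', a'⟩) _ _)
    · exact absurd h.symm (hPK j a' k' _ _)
    · obtain ⟨h1, h2⟩ := coreLabel_inj hET k.2 k'.2 h
      obtain rfl := Fin.ext h2
      obtain rfl := Fin.ext h1
      rfl
  · rintro (⟨i, b, a⟩ | ⟨i, a, k⟩ | ⟨l, k⟩) <;>
      simp only [BookEdge.toSym2, bookLabel_inl_inl, bookLabel_inl_inr, bookLabel_inr_inr]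
    · exact Nat.succ_pos _
    · exact Nat.succ_pos _
    · exact Nat.succ_pos _
  · rw [card_bookEdge]
    rintro (⟨i, b, a⟩ | ⟨i, a, k⟩ | ⟨l, k⟩) <;>
      simp only [BookEdge.toSym2, bookLabel_inl_inl, bookLabel_inl_inr, bookLabel_inr_inr]
    · have := innerLabel_le i.2 a.2.ne (a.2.trans b.2) b.2
      omega
    · have := hpT i.2 a.2 k.2
      omega
    · exact coreLabel_le hET k.2.ne (k.2.trans l.2) l.2
  · intro i a
    have h1 := sum_innerLabel_sub i.2 a
    have h2 := sum_pendant_sub hc hR hsR i.2 a.2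
    rw [← Fin.sum_univ_eq_sum_range
      (fun k => (pendant m s R y z w i a k : ℤ) - pendant m s R y z w 0 a k),
      Finset.sum_sub_distrib, ← hp] at h2
    zify at h1 ⊢
    simp only [Finset.sum_add_distrib]
    linarith
  · refine StrictMono.injective fun a b hab => ?_
    refine add_lt_add_of_le_of_lt (sum_ite_le_sum_ite (F := fun a b : Fin s => innerLabel m 0 a b)
      (fun a b => innerLabel_comm m 0 a b) fun l hla hlb => innerLabel_le_innerLabel hm
        (Fin.val_ne_of_ne hla) (Fin.val_ne_of_ne hlb) hab) ?_
    have : Nonempty (Fin R) := ⟨⟨0, by omega⟩⟩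
    refine Finset.sum_lt_sum_of_nonempty Finset.univ_nonempty fun k _ => ?_
    have : p 0 a k < p 0 b k := pendant_lt_of_middle_lt hy hz hm hab b.2 hR3
    omega
  · refine StrictMono.injective fun k l hkl => ?_
    refine add_lt_add_of_lt_of_le ?_ (sum_ite_le_sum_ite
      (F := fun a b : Fin R => coreLabel T E a b) (fun a b => coreLabel_comm T E a b)
      fun x hx hx' => coreLabel_le_coreLabel hET (Fin.val_ne_of_ne hx) (Fin.val_ne_of_ne hx') hkl)
    have : Nonempty (Fin s) := ⟨⟨0, hs⟩⟩
    refine Finset.sum_lt_sum_of_nonempty Finset.univ_nonempty fun i _ =>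
      Finset.sum_lt_sum_of_nonempty Finset.univ_nonempty fun a _ => ?_
    have : p i a k < p i a l := pendant_lt_of_right_lt hy hz i.2 a.2 hR3 hkl l.2
    omega
  -- Crude bounds suffice: inner labels are at most A, the pendant label at k is at most A + ms(k +
  -- 1) + 1, every pendant label is at least A + 1, and every core label exceeds E.
  · intro a k
    have h1 : (∑ b, if b = a then 0 else innerLabel m 0 b a) ≤ (s - 1) * A := by
      rw [← sum_ite_const a A]
      refine Finset.sum_le_sum fun b _ => ?_
      split_ifs with h
      · exact le_rfl
      · exact innerLabel_le hm (Fin.val_ne_of_ne h) b.2 a.2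
    have h2 : ∑ k : Fin R, (A + p 0 a k + 1) ≤
        R * A + m * s * (∑ k ∈ Finset.range R, (k + 1)) + R := by
      rw [← Fin.sum_univ_eq_sum_range (fun k => k + 1), Finset.mul_sum]
      calc ∑ k : Fin R, (A + p 0 a k + 1) ≤ ∑ k : Fin R, (A + m * s * (k + 1) + 1) := by
            refine Finset.sum_le_sum fun k _ => ?_
            have : p 0 a k ≤ m * (s * (k + 1)) := pendant_le_mul_row hy hz hw' hm a.2
            rw [← mul_assoc] at this
            omega
        _ = _ := by simp [Finset.sum_add_distrib]
    have h3 : m * (s * (A + 1)) ≤ ∑ i : Fin m, ∑ a : Fin s, (A + p i a k + 1) := by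
      calc m * (s * (A + 1)) = ∑ i : Fin m, ∑ a : Fin s, (A + 1) := by simp
        _ ≤ _ := Finset.sum_le_sum fun i _ => Finset.sum_le_sum fun a _ => by omega
    have h4 : (R - 1) * (A + m * (s * R - 1) + 1) ≤
        ∑ l : Fin R, if l = k then 0 else coreLabel T E l k := by
      rw [← sum_ite_const k]
      refine Finset.sum_le_sum fun l _ => ?_
      split_ifs with h
      · exact le_rfl
      · have := lt_coreLabel hET (l : ℕ) k
        omega
    have hS : (∑ k ∈ Finset.range R, (k + 1)) * 2 = R * (R + 1) := by
      have := Finset.sum_range_id_mul_two (R + 1)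
      rw [Finset.sum_range_succ'] at this
      simpa [mul_comm] using this
    have h5 := own_lt_common (A := A) hm hs hR hsR hS hB
    exact (add_le_add h1 h2).trans_lt (h5.trans_le (add_le_add h3 h4))

end Assembly

/-! ### Invariance under graph isomorphism. -/

section Isomorphism

variable {V W : Type*} [Fintype V] [Fintype W] {G : SimpleGraph V} {H : SimpleGraph W}

theorem vertexSum_comp_iso (e : G ≃g H) (g : Sym2 W → ℕ) (v : V) :
    vertexSum G (fun x => g (x.map e)) v = vertexSum H g (e v) := by
  classical
  rw [vertexSum_eq_sum_ite, vertexSum_eq_sum_ite, ← Equiv.sum_comp e.toEquiv]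
  refine Finset.sum_congr rfl fun u _ => ?_
  simp [SimpleGraph.Iso.map_adj_iff]

theorem localAntimagicChromaticNumber_le_of_iso (e : G ≃g H) :
    localAntimagicChromaticNumber G ≤ localAntimagicChromaticNumber H := by
  refine le_iInf fun g => ?_
  have hbij : Set.BijOn (Sym2.map e) G.edgeSet H.edgeSet := by
    refine ⟨?_, (Sym2.map.injective e.injective).injOn, ?_⟩
    · intro x
      induction x with | _ u v => exact e.map_adj_iff.2
    · intro x
      induction x with
      | _ u v =>
        intro h
        refine ⟨s(e.symm u, e.symm v), e.symm.map_adj_iff.2 h, ?_⟩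
        simp
  have hcard : G.edgeSet.ncard = H.edgeSet.ncard := by
    rw [← hbij.image_eq, hbij.injOn.ncard_image]
  have hg : IsLocalAntimagicLabeling G (fun x => g.1 (x.map e)) := by
    refine ⟨?_, fun u v h => ?_⟩
    · rw [hcard]
      exact g.2.1.comp hbij
    · rw [vertexSum_comp_iso, vertexSum_comp_iso]
      exact g.2.2 _ _ (e.map_adj_iff.2 h)
  refine (iInf_le _ ⟨_, hg⟩).trans (Nat.cast_le.2 (Set.ncard_le_ncard ?_ (Set.finite_range _)))
  rintro _ ⟨v, rfl⟩
  exact ⟨e v, (vertexSum_comp_iso e g.1 v).symm⟩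

theorem localAntimagicChromaticNumber_congr (e : G ≃g H) :
    localAntimagicChromaticNumber G = localAntimagicChromaticNumber H :=
  le_antisymm (localAntimagicChromaticNumber_le_of_iso e)
    (localAntimagicChromaticNumber_le_of_iso e.symm)

end Isomorphism

/-! ### Amalgamations and joins as book graphs. -/

section Amalgamation

theorem copyVertex_eq_inl {V : Type*} [DecidableEq V] {m : ℕ} {S : Finset V} {i : Fin m} {x : V}
    {p : Fin m × {x : V // x ∉ S}} (h : Sum.inl p = copyVertex S i x) : p.1 = i := by
  unfold copyVertex at h
  split_ifs at h
  rw [Sum.inl.inj h]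

theorem amalgamation_top {V : Type*} [DecidableEq V] {m : ℕ} (hm : 0 < m) (S : Finset V) :
    amalgamation m (⊤ : SimpleGraph V) S =
      bookGraph (Fin m) {x : V // x ∉ S} {x : V // x ∈ S} := by
  have hl : ∀ (i : Fin m) (x : {x : V // x ∉ S}), Sum.inl (i, x) = copyVertex S i (x : V) :=
    fun i x => by rw [copyVertex, dif_neg x.2]
  have hr : ∀ (i : Fin m) (x : {x : V // x ∈ S}), Sum.inr x = copyVertex S i (x : V) :=
    fun i x => by rw [copyVertex, dif_pos x.2]
  have hne : ∀ {i : Fin m} {x y : V}, copyVertex S i x ≠ copyVertex S i y → x ≠ y := by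
    rintro i x _ h rfl
    exact h rfl
  have key : ∀ u v : AmalgamationVertex m S, u ≠ v →
      (∀ p q, u = Sum.inl p → v = Sum.inl q → p.1 = q.1) →
      ∃ (i : Fin m) (x y : V), u = copyVertex S i x ∧ v = copyVertex S i y := by
    rintro (⟨i, a⟩ | k) (⟨j, b⟩ | l) h h'
    · obtain rfl : i = j := h' _ _ rfl rfl
      exact ⟨i, a, b, hl i a, hl i b⟩
    · exact ⟨i, a, l, hl i a, hr i l⟩
    · exact ⟨j, k, b, hr j k, hl j b⟩
    -- An edge between common vertices lies in every copy, so any copy serves, but one must exist.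
    · exact ⟨⟨0, hm⟩, k, l, hr _ k, hr _ l⟩
  ext u v
  rw [amalgamation, SimpleGraph.fromRel_adj]
  constructor
  · rintro ⟨h, ⟨i, x, y, -, hu, hv⟩ | ⟨i, x, y, -, hv, hu⟩⟩
    all_goals
      refine ⟨h, fun p q hp hq => ?_⟩
      rw [copyVertex_eq_inl (hp.symm.trans hu), copyVertex_eq_inl (hq.symm.trans hv)]
  · rintro ⟨h, h'⟩
    obtain ⟨i, x, y, rfl, rfl⟩ := key u v h h'
    exact ⟨h, Or.inl ⟨i, x, y, hne h, rfl, rfl⟩⟩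

/-- `bookGraph` is functorial in its arguments. -/
def bookGraphCongr {ι β γ β' γ' : Type*} (e : β ≃ β') (f : γ ≃ γ') :
    bookGraph ι β γ ≃g bookGraph ι β' γ' where
  toEquiv := Equiv.sumCongr (Equiv.prodCongr (Equiv.refl ι) e) f
  map_rel_iff' := by
    rintro (⟨i, a⟩ | k) (⟨j, b⟩ | l)
    · simp [bookGraph_adj_inl_inl]
    · exact iff_of_true bookGraph_adj_inl_inr bookGraph_adj_inl_inr
    · exact iff_of_true bookGraph_adj_inr_inl bookGraph_adj_inr_inl
    · simp [bookGraph_adj_inr_inr]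

/-- Joining a complete graph to a book enlarges the set of common vertices. -/
def joinBookGraph (ι β γ δ : Type*) :
    join (bookGraph ι β γ) (⊤ : SimpleGraph δ) ≃g bookGraph ι β (γ ⊕ δ) where
  toEquiv := Equiv.sumAssoc _ _ _
  map_rel_iff' := by
    rintro ((⟨i, a⟩ | k) | x) ((⟨j, b⟩ | l) | y) <;>
      simp [join, bookGraph_adj_inl_inl, bookGraph_adj_inl_inr, bookGraph_adj_inr_inl,
        bookGraph_adj_inr_inr]

theorem card_lastVertices {n r : ℕ} (h : r ≤ n) : (lastVertices n r).card = r := by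
  have : lastVertices n r = Finset.univ.filter fun j : Fin n => ¬ (j : ℕ) < n - r := by
    ext j
    simp only [lastVertices, Finset.mem_filter, Finset.mem_univ, true_and]
    omega
  have h2 := Finset.card_filter_add_card_filter_not (s := (Finset.univ : Finset (Fin n)))
    (fun j : Fin n => (j : ℕ) < n - r)
  rw [Fin.card_filter_val_lt, ← this, Finset.card_univ, Fintype.card_fin] at h2
  omega

end Amalgamation

end LocalAntimagic

open LocalAntimagic in
theorem mainTheorem8 (m n r : ℕ) (hm : 2 ≤ m) (hn : Odd n) (hr : 3 ≤ r) (hrn : r < n) :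
    LocalAntimagic.localAntimagicChromaticNumber
        (LocalAntimagic.amalgamationComplete m (n + 1) (r + 1)) =
      LocalAntimagic.localAntimagicChromaticNumber
        (LocalAntimagic.join (LocalAntimagic.amalgamationComplete m n r)
          (⊤ : SimpleGraph (Fin 1))) ∧
    LocalAntimagic.localAntimagicChromaticNumber
        (LocalAntimagic.join (LocalAntimagic.amalgamationComplete m n r)
          (⊤ : SimpleGraph (Fin 1))) = ((n + 1 : ℕ) : ℕ∞) := by
  have key := localAntimagicChromaticNumber_bookGraph m (n - r) (r + 1) (by omega) (by omega)
    (by omega) (by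
      rw [show n - r + (r + 1) = n + 1 by omega]
      exact hn.add_one)
  rw [show n - r + (r + 1) = n + 1 by omega] at key
  have h1 : localAntimagicChromaticNumber (amalgamationComplete m (n + 1) (r + 1)) =
      ((n + 1 : ℕ) : ℕ∞) := by
    rw [← key, amalgamationComplete, amalgamation_top (by omega)]
    refine localAntimagicChromaticNumber_congr (bookGraphCongr
      (Fintype.equivFinOfCardEq ?_) (Fintype.equivFinOfCardEq ?_))
    · rw [Fintype.card_subtype_compl, Fintype.card_coe, card_lastVertices (by omega),
        Fintype.card_fin]
      omega
    · rw [Fintype.card_coe, card_lastVertices (by omega)]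
  have h2 : localAntimagicChromaticNumber (join (amalgamationComplete m n r)
      (⊤ : SimpleGraph (Fin 1))) = ((n + 1 : ℕ) : ℕ∞) := by
    rw [← key, amalgamationComplete, amalgamation_top (by omega)]
    refine localAntimagicChromaticNumber_congr ((joinBookGraph _ _ _ _).trans (bookGraphCongr
      (Fintype.equivFinOfCardEq ?_) (Fintype.equivFinOfCardEq ?_)))
    · rw [Fintype.card_subtype_compl, Fintype.card_coe, card_lastVertices (by omega),
        Fintype.card_fin]
    · rw [Fintype.card_sum, Fintype.card_coe, card_lastVertices (by omega), Fintype.card_fin]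
  exact ⟨h1.trans h2.symm, h2⟩
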